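/- Let $k\in\mathbb R$, let $r,m\ge 0$ be integers, and let $\mathcal O_{k+1}$ be the domain of holomorphic functions on the half plane $\operatorname{Re} z>k+1$. Let $\mathcal D_k$ be the set of arithmetic functions $\alpha:\{1,2,3,\dots\}\to\mathbb C$ such that for every $\varepsilon>0$ there is $C>0$ with $|\alpha(n)|\le C n^{k+\varepsilon}$ for all $n\ge 1$. For $\alpha\in\mathcal D_k$ let $F(\alpha)(z)=\sum_{n\ge 1}\alpha(n)n^{-z}\in\mathcal O_{k+1}$ be its Dirichlet series and $F^{(i)}(\alpha)\in\mathcal O_{k+1}$ its $i$-th derivative. Call two multiplicative functions $\alpha,\beta$ equivalent if, for all but finitely many primes $p$, $\alpha(p^j)=\beta(p^j)$ for all integers $j\ge 1$. Let $e$ be the function with $e(1)=1$ and $e(n)=0$ for $n\ge 2$. Let $$\mathcal B_{k+1}=\{f\in\mathcal O_{k+1}:\ \lim_{x\to+\infty}e^{-ax}|f(x)|=0\ \text{for all } a>0\},$$ $$\mathcal I_{k+1}=\{f\in\mathcal O_{k+1}:\ \lim_{x\to+\infty}e^{ax}|f(x)|=0\ \text{for some } a>0\},$$ the limits being taken along the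 real line. Let $\mathcal A_{k+1}$ be any $\mathbb C$-subalgebra of $\mathcal O_{k+1}$ contained in $(\mathcal B_{k+1}\setminus\mathcal I_{k+1})\cup\{0\}$, and let $\mathcal F_{k+1}$ be its field of fractions, a subfield of the field of fractions of $\mathcal O_{k+1}$. Let $\alpha_1,\dots,\alpha_r\in\mathcal D_k$ be multiplicative functions (so $\alpha_j(1)=1$) such that $e,\alpha_1,\dots,\alpha_r$ are pairwise non-equivalent. Then the functions $F^{(i)}(\alpha_j)$, $0\le i\le m$, $1\le j\le r$, are linearly independent over $\mathcal F_{k+1}$. In particular, they are linearly independent over the field of meromorphic functions of order $<1$, that is, the field of quotients $f/g$ of entire functions $f,g$ ($g\ne 0$) of order of growth $<1$; here the order of growth of an entire function $f$ is the infimum of the $\rho>0$ for which there are $A,B>0$ with $|f(z)|\le Ae^{B|z|^\rho}$ for all $z\in\mathbb C$. -/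

import Mathlib

open Filter Topology

noncomputable section

namespace DirichletIndep

/-- The open half plane `Re z > k`. -/
abbrev HalfPlane (k : ℝ) : Type := {z : ℂ // k < z.re}

/-- The `ℂ`-algebra `𝒪_k` of holomorphic functions on the half plane `Re z > k`. -/
def Hol (k : ℝ) : Subalgebra ℂ (HalfPlane k → ℂ) where
  carrier := {f | ∃ g : ℂ → ℂ, DifferentiableOn ℂ g {z | k < z.re} ∧ ∀ z, f z = g z}
  mul_mem' := by
    rintro f₁ f₂ ⟨g₁, h₁, e₁⟩ ⟨g₂, h₂, e₂⟩
    exact ⟨g₁ * g₂, h₁.mul h₂, fun z => by simp [e₁, e₂]⟩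
  add_mem' := by
    rintro f₁ f₂ ⟨g₁, h₁, e₁⟩ ⟨g₂, h₂, e₂⟩
    exact ⟨g₁ + g₂, h₁.add h₂, fun z => by simp [e₁, e₂]⟩
  algebraMap_mem' c := ⟨fun _ => c, differentiableOn_const c, fun _ => rfl⟩

/-- `𝒪_k` is an integral domain, so that its fraction ring, the field of meromorphic functions
on `Re z > k`, is a field. -/
instance Hol.instIsDomain (k : ℝ) : IsDomain (Hol k) := by
  have hopen : IsOpen {z : ℂ | k < z.re} := isOpen_lt continuous_const Complex.continuous_re
  have : Nontrivial (Hol k) := by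
    refine ⟨0, 1, fun h => ?_⟩
    have := congrFun (congrArg Subtype.val h) ⟨((k + 1 : ℝ) : ℂ), by simp⟩
    simp at this
  have : NoZeroDivisors (Hol k) := by
    refine ⟨?_⟩
    rintro ⟨f₁, g₁, h₁, e₁⟩ ⟨f₂, g₂, h₂, e₂⟩ h
    have hz : ∀ z ∈ {z : ℂ | k < z.re}, (g₁ * g₂) z = 0 := by
      intro z hz
      have := congrFun (congrArg Subtype.val h) ⟨z, hz⟩
      simpa [e₁, e₂] using this
    have hc : IsPreconnected {z : ℂ | k < z.re} := (convex_halfSpace_re_gt k).isPreconnected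
    rcases (h₁.analyticOnNhd hopen).eq_zero_or_eq_zero_of_mul_eq_zero
      (h₂.analyticOnNhd hopen) (fun z hz' => hz z hz') hc with h0 | h0
    · left
      ext z
      simpa [e₁] using h0 z z.2
    · right
      ext z
      simpa [e₂] using h0 z z.2
  exact NoZeroDivisors.to_isDomain _

/-- The field of meromorphic functions on `Re z > k`: the field of fractions of `𝒪_k`. -/
def Mer (k : ℝ) : Type := FractionRing (Hol k)

instance Mer.instField (k : ℝ) : Field (Mer k) := inferInstanceAs (Field (FractionRing (Hol k)))

instance Mer.instAlgebra (k : ℝ) : Algebra (Hol k) (Mer k) :=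
  inferInstanceAs (Algebra (Hol k) (FractionRing (Hol k)))

instance Mer.instIsFractionRing (k : ℝ) : IsFractionRing (Hol k) (Mer k) :=
  inferInstanceAs (IsFractionRing (Hol k) (FractionRing (Hol k)))

/-- The value at a real point `x > k` of a function on the half plane `Re z > k`. -/
def evalReal {k : ℝ} (f : Hol k) (x : Set.Ioi k) : ℂ := f.1 ⟨((x : ℝ) : ℂ), x.2⟩

/-- `ℬ_k`: the functions `f ∈ 𝒪_k` such that `e^{-ax} |f(x)| → 0` as `x → +∞`
for every `a > 0`. -/
def subexp (k : ℝ) : Set (Hol k) :=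
  {f | ∀ a : ℝ, 0 < a →
    Tendsto (fun x : Set.Ioi k => Real.exp (-a * x) * ‖evalReal f x‖) atTop (𝓝 0)}

/-- `ℐ_k`: the functions `f ∈ 𝒪_k` such that `e^{ax} |f(x)| → 0` as `x → +∞`
for some `a > 0`. -/
def expDecay (k : ℝ) : Set (Hol k) :=
  {f | ∃ a : ℝ, 0 < a ∧
    Tendsto (fun x : Set.Ioi k => Real.exp (a * x) * ‖evalReal f x‖) atTop (𝓝 0)}

/-- The field of fractions of a subalgebra `A` of `𝒪_k`, inside the field of meromorphic functions
on `Re z > k`. -/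
def quotientField {k : ℝ} (A : Subalgebra ℂ (Hol k)) : Subfield (Mer k) :=
  Subfield.closure (algebraMap (Hol k) (Mer k) '' (A : Set (Hol k)))

theorem mem_quotientField {k : ℝ} (A : Subalgebra ℂ (Hol k)) (x : Mer k) :
    x ∈ quotientField A ↔ ∃ a ∈ A, ∃ b ∈ A,
      algebraMap (Hol k) (Mer k) a / algebraMap (Hol k) (Mer k) b
        = x := by
  have h : Subring.closure (algebraMap (Hol k) (Mer k) '' (A : Set (Hol k)))
      = A.toSubring.map (algebraMap (Hol k) (Mer k)) := by
    rw [← RingHom.map_closure]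
    congr 1
    exact Subring.closure_eq A.toSubring
  rw [quotientField, Subfield.mem_closure_iff, h]
  simp

/-- The `ℂ`-algebra of entire functions. -/
def Entire : Subalgebra ℂ (ℂ → ℂ) where
  carrier := {f | Differentiable ℂ f}
  mul_mem' := fun h₁ h₂ => h₁.mul h₂
  add_mem' := fun h₁ h₂ => h₁.add h₂
  algebraMap_mem' c := differentiable_const c

/-- Order of growth `≤ ρ`. -/
def HasGrowth (f : ℂ → ℂ) (ρ : ℝ) : Prop :=
  ∃ A B : ℝ, 0 < A ∧ 0 < B ∧ ∀ z : ℂ, ‖f z‖ ≤ A * Real.exp (B * ‖z‖ ^ ρ)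

/-- The order of growth of `f`, the infimum of the `ρ > 0` such that `f` has an order of growth
`≤ ρ` (it is `⊤` if there is no such `ρ`). -/
def growthOrder (f : ℂ → ℂ) : EReal :=
  sInf {x : EReal | ∃ ρ : ℝ, 0 < ρ ∧ HasGrowth f ρ ∧ x = ρ}

theorem growthOrder_lt_iff (f : ℂ → ℂ) (σ : ℝ) :
    growthOrder f < σ ↔ ∃ ρ : ℝ, 0 < ρ ∧ ρ < σ ∧ HasGrowth f ρ := by
  rw [growthOrder, sInf_lt_iff]
  constructor
  · rintro ⟨_, ⟨ρ, h0, hg, rfl⟩, hlt⟩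
    exact ⟨ρ, h0, by exact_mod_cast hlt, hg⟩
  · rintro ⟨ρ, h0, hlt, hg⟩
    exact ⟨ρ, ⟨ρ, h0, hg, rfl⟩, by exact_mod_cast hlt⟩

theorem HasGrowth.mono {f : ℂ → ℂ} {ρ σ : ℝ} (h : HasGrowth f ρ) (h0 : 0 < ρ) (hle : ρ ≤ σ) :
    HasGrowth f σ := by
  obtain ⟨A, B, hA, hB, h⟩ := h
  refine ⟨A * Real.exp B, B, by positivity, hB, fun z => (h z).trans ?_⟩
  rw [mul_assoc, ← Real.exp_add]
  gcongr
  have key : ‖z‖ ^ ρ ≤ 1 + ‖z‖ ^ σ := by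
    rcases le_total ‖z‖ 1 with hz | hz
    · have h1 := Real.rpow_le_one (norm_nonneg z) hz h0.le
      have h2 := Real.rpow_nonneg (norm_nonneg z) σ
      linarith
    · have := Real.rpow_le_rpow_of_exponent_le hz hle
      linarith
  nlinarith

theorem HasGrowth.mul {f g : ℂ → ℂ} {ρ : ℝ} (hf : HasGrowth f ρ) (hg : HasGrowth g ρ) :
    HasGrowth (f * g) ρ := by
  obtain ⟨A, B, hA, hB, hf⟩ := hf
  obtain ⟨A', B', hA', hB', hg⟩ := hg
  refine ⟨A * A', B + B', by positivity, by positivity, fun z => ?_⟩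
  calc ‖(f * g) z‖ = ‖f z‖ * ‖g z‖ := by simp
    _ ≤ (A * Real.exp (B * ‖z‖ ^ ρ)) * (A' * Real.exp (B' * ‖z‖ ^ ρ)) := by
        gcongr
        · exact hf z
        · exact hg z
    _ = _ := by rw [add_mul, Real.exp_add]; ring

theorem HasGrowth.add {f g : ℂ → ℂ} {ρ : ℝ} (hf : HasGrowth f ρ) (hg : HasGrowth g ρ) :
    HasGrowth (f + g) ρ := by
  obtain ⟨A, B, hA, hB, hf⟩ := hf
  obtain ⟨A', B', hA', hB', hg⟩ := hg
  refine ⟨A + A', B + B', by positivity, by positivity, fun z => ?_⟩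
  have hr := Real.rpow_nonneg (norm_nonneg z) ρ
  calc ‖(f + g) z‖ ≤ ‖f z‖ + ‖g z‖ := norm_add_le _ _
    _ ≤ A * Real.exp (B * ‖z‖ ^ ρ) + A' * Real.exp (B' * ‖z‖ ^ ρ) := add_le_add (hf z) (hg z)
    _ ≤ A * Real.exp ((B + B') * ‖z‖ ^ ρ) + A' * Real.exp ((B + B') * ‖z‖ ^ ρ) := by
        gcongr <;> linarith
    _ = _ := by ring

/-- The algebra `𝒪_{<1}` of entire functions of order of growth `< 1`. -/
def entireOrderLTOne : Subalgebra ℂ Entire where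
  carrier := {f | growthOrder f.1 < (1 : ℝ)}
  mul_mem' := by
    rintro f g hf hg
    simp only [Set.mem_ofPred_eq, growthOrder_lt_iff] at hf hg ⊢
    obtain ⟨ρ, h0, h1, h⟩ := hf
    obtain ⟨ρ', h0', h1', h'⟩ := hg
    exact ⟨max ρ ρ', lt_max_of_lt_left h0, max_lt h1 h1',
      (h.mono h0 (le_max_left _ _)).mul (h'.mono h0' (le_max_right _ _))⟩
  add_mem' := by
    rintro f g hf hg
    simp only [Set.mem_ofPred_eq, growthOrder_lt_iff] at hf hg ⊢
    obtain ⟨ρ, h0, h1, h⟩ := hf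
    obtain ⟨ρ', h0', h1', h'⟩ := hg
    exact ⟨max ρ ρ', lt_max_of_lt_left h0, max_lt h1 h1',
      (h.mono h0 (le_max_left _ _)).add (h'.mono h0' (le_max_right _ _))⟩
  algebraMap_mem' c := by
    simp only [Set.mem_ofPred_eq, growthOrder_lt_iff]
    refine ⟨1 / 2, by norm_num, by norm_num, ‖c‖ + 1, 1, by positivity, one_pos, fun z => ?_⟩
    have h1 : (1 : ℝ) ≤ Real.exp (1 * ‖z‖ ^ (1 / 2 : ℝ)) := Real.one_le_exp (by positivity)
    have h2 : ‖(algebraMap ℂ Entire c).1 z‖ = ‖c‖ := rfl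
    rw [h2]
    nlinarith [norm_nonneg c]

/-- Restriction of entire functions to the half plane `Re z > k`. -/
def restrict (k : ℝ) : Entire →ₐ[ℂ] Hol k where
  toFun f := ⟨fun z => f.1 z, f.1, Differentiable.differentiableOn f.2, fun _ => rfl⟩
  map_one' := rfl
  map_mul' _ _ := rfl
  map_zero' := rfl
  map_add' _ _ := rfl
  commutes' _ := rfl

/-- The field of meromorphic functions of order `< 1`, that is, of the quotients of entire
functions of order `< 1`, viewed as meromorphic functions on `Re z > k`. -/
def meromorphicOrderLTOne (k : ℝ) : Subfield (Mer k) :=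
  quotientField (entireOrderLTOne.map (restrict k))

/-- `𝒟_k`: the arithmetic functions that are `O(n^{k+ε})` for every `ε > 0`. -/
def polyGrowth (k : ℝ) : Set (ArithmeticFunction ℂ) :=
  {α | ∀ ε : ℝ, 0 < ε → ∃ C : ℝ, 0 < C ∧ ∀ n : ℕ, 1 ≤ n → ‖α n‖ ≤ C * (n : ℝ) ^ (k + ε)}

/-- Equivalence of (multiplicative) arithmetic functions: for all but finitely many primes `p`,
they agree at all powers `p ^ j`, `j ≥ 1`. -/
def Equivalent (α β : ArithmeticFunction ℂ) : Prop :=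
  {p : ℕ | p.Prime ∧ ∃ j : ℕ, 1 ≤ j ∧ α (p ^ j) ≠ β (p ^ j)}.Finite

theorem abscissa_le {k : ℝ} {α : ArithmeticFunction ℂ} (hα : α ∈ polyGrowth k) :
    LSeries.abscissaOfAbsConv α ≤ ((k + 1 : ℝ) : EReal) := by
  refine EReal.le_of_forall_lt_iff_le.mp fun y hy => ?_
  have hy' : k + 1 < y := by exact_mod_cast hy
  obtain ⟨C, _, hC⟩ := hα (y - (k + 1)) (by linarith)
  have := LSeries.abscissaOfAbsConv_le_of_le_const_mul_rpow (f := α) (x := k + (y - (k + 1)))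
    ⟨C, fun n hn => hC n (Nat.one_le_iff_ne_zero.mpr hn)⟩
  refine this.trans (le_of_eq ?_)
  norm_cast
  ring

/-- The `i`-th derivative `F^{(i)}(α)` of the Dirichlet series `F(α)(z) = ∑ α(n) n^{-z}` of
`α ∈ 𝒟_k`, as a holomorphic function on `Re z > k + 1`. -/
def dirichletDeriv {k : ℝ} (α : ArithmeticFunction ℂ) (hα : α ∈ polyGrowth k) (i : ℕ) :
    Hol (k + 1) :=
  ⟨fun z => iteratedDeriv i (LSeries α) z, iteratedDeriv i (LSeries α), by
    have hA := LSeries_analyticOnNhd (α : ℕ → ℂ)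
    intro z hz
    have hz' : LSeries.abscissaOfAbsConv α < z.re :=
      (abscissa_le hα).trans_lt (by exact_mod_cast hz)
    rw [iteratedDeriv_eq_iterate]
    exact ((hA.iterated_deriv i) z hz').differentiableAt.differentiableWithinAt,
    fun _ => rfl⟩

end DirichletIndep

end

noncomputable section

namespace DirichletIndep

/-! After clearing denominators, a dependence reads `∑ a_{ji} F^{(i)}(α_j) = 0` with `a_{ji} ∈ A`.
The series `F^{(i)}(α_j)` has coefficients `(-log n)^i α_j(n)`; put `b_n = ∑ (-log n)^i α_j(n)
a_{ji} ∈ A`. If `b_1, …, b_{n-1}` vanish, then `b_n n^{-x}` is minus a tail of size `(n+1)^{-x}` up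
to subexponential factors, so `b_n` decays exponentially, and the hypothesis on `A` forces `b_n = 0`
(`sum_smul_eq_zero_of_sum_mul_LSeries_eq_zero`).

At a fixed point `z` this gives `∑ α_j(n) Q_j(log n) = 0` for all `n ≥ 1`, with polynomials `Q_j`.
As in Artin's proof of the independence of characters, replacing `n` by `q n` for a prime power `q`
and subtracting a multiple of the original relation lowers the degrees, until all `Q_j` vanish
(`eq_zero_of_sum_mul_eval_log_eq_zero`).

Entire functions of order `< 1` form an admissible algebra: they are subexponential, and by
Phragmén–Lindelöf a nonzero one cannot decay exponentially on the positive axis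
(`eq_zero_of_hasGrowth_of_exp_decay`). -/

/-! ### Independence of multiplicative functions times powers of `log` -/

open Polynomial in
/-- `deg p + 1`, with the convention that the zero polynomial has weight `0`. -/
def polyWeight (p : ℂ[X]) : ℕ := if p = 0 then 0 else p.natDegree + 1

open Polynomial in
theorem polyWeight_le_of_natDegree_le {p q : ℂ[X]} (hq : q ≠ 0) (h : p.natDegree ≤ q.natDegree) :
    polyWeight p ≤ polyWeight q := by
  unfold polyWeight
  split_ifs <;> omega

-- A nonzero constant that becomes zero must count as a drop, which `natDegree` alone does not see.
open Polynomial in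
theorem polyWeight_lt_of_coeff_eq_zero {p q : ℂ[X]} (hq : q ≠ 0)
    (h : p.natDegree ≤ q.natDegree) (hc : p.coeff q.natDegree = 0) :
    polyWeight p < polyWeight q := by
  unfold polyWeight
  split_ifs with hp
  · omega
  · have : p.natDegree ≠ q.natDegree := by
      intro he
      rw [← he, coeff_natDegree, leadingCoeff_eq_zero] at hc
      exact hp hc
    omega

open Polynomial in
/-- The polynomial obtained from `Q` by applying the operator `f ↦ a f(· + t) - b f`. -/
def shiftSub (a b t : ℂ) (Q : ℂ[X]) : ℂ[X] := C a * taylor t Q - C b * Q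

open Polynomial in
theorem natDegree_shiftSub_le (a b t : ℂ) (Q : ℂ[X]) :
    (shiftSub a b t Q).natDegree ≤ Q.natDegree := by
  refine (natDegree_sub_le _ _).trans (max_le ?_ (natDegree_C_mul_le _ _))
  exact (natDegree_C_mul_le _ _).trans (natDegree_taylor Q t).le

-- Translation preserves the leading term. Hence the degree drops when `a = b` and a nonzero `Q`
-- stays nonzero when `a ≠ b`; the elimination uses both.
open Polynomial in
theorem coeff_shiftSub (a b t : ℂ) (Q : ℂ[X]) :
    (shiftSub a b t Q).coeff Q.natDegree = (a - b) * Q.leadingCoeff := by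
  rw [shiftSub, coeff_sub, coeff_C_mul, coeff_C_mul, coeff_taylor_natDegree, coeff_natDegree]
  ring

open Polynomial in
theorem eval_shiftSub (a b t x : ℂ) (Q : ℂ[X]) :
    (shiftSub a b t Q).eval x = a * Q.eval (x + t) - b * Q.eval x := by
  simp [shiftSub, taylor_eval]

/-- If `α` and `β` are not equivalent, then for infinitely many primes `p` they differ at
a power of `p`; in particular this happens for a prime that does not divide `N`. -/
theorem infinite_setOf_prime_not_dvd {α β : ArithmeticFunction ℂ} (h : ¬ Equivalent α β) {N : ℕ}
    (hN : N ≠ 0) :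
    {p : ℕ | p.Prime ∧ ¬ p ∣ N ∧ ∃ j : ℕ, 1 ≤ j ∧ α (p ^ j) ≠ β (p ^ j)}.Infinite := by
  intro hfin
  refine h ((hfin.union N.divisors.finite_toSet).subset ?_)
  rintro p ⟨hp, hj⟩
  by_cases hd : p ∣ N
  · right
    simpa using ⟨hd, hN⟩
  · exact Or.inl ⟨hp, hd, hj⟩

-- Non-equivalence to `1` gives infinitely many primes `p ∤ N` having a power at which `α` is
-- nonzero. The logarithms of these powers are distinct by unique factorisation, so `Q` has
-- infinitely many roots.
open Polynomial in
theorem eq_zero_of_mul_eval_log_eq_zero {α : ArithmeticFunction ℂ} (hne : ¬ Equivalent 1 α)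
    {N : ℕ} (hN : N ≠ 0) {Q : ℂ[X]}
    (h : ∀ n : ℕ, n ≠ 0 → n.Coprime N → α n * Q.eval (Real.log n : ℂ) = 0) : Q = 0 := by
  by_contra hQ
  have hinf := infinite_setOf_prime_not_dvd hne hN
  choose! e he using
    fun p (hp : p ∈ {p : ℕ | p.Prime ∧ ¬ p ∣ N ∧
      ∃ j : ℕ, 1 ≤ j ∧ (1 : ArithmeticFunction ℂ) (p ^ j) ≠ α (p ^ j)}) => hp.2.2
  refine hinf (Set.Finite.of_finite_image (f := fun p => ((Real.log (p ^ e p : ℕ) : ℝ) : ℂ))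
    (Q.roots.toFinset.finite_toSet.subset ?_) ?_)
  · rintro _ ⟨p, hp, rfl⟩
    have hp1 : p.Prime := hp.1
    obtain ⟨hj, hα⟩ := he p hp
    have h1 : (1 : ArithmeticFunction ℂ) (p ^ e p) = 0 := by
      rw [ArithmeticFunction.one_apply_ne]
      exact (Nat.one_lt_pow (by omega) hp1.one_lt).ne'
    rw [h1] at hα
    have := h (p ^ e p) (pow_ne_zero _ hp1.ne_zero)
      (((Nat.Prime.coprime_iff_not_dvd hp1).2 hp.2.1).pow_left _)
    rcases mul_eq_zero.1 this with h0 | h0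
    · exact absurd h0.symm hα
    · simpa [hQ] using h0
  · intro p hp q hq hpq
    have hp1 : p.Prime := hp.1
    have hq1 : q.Prime := hq.1
    have h1 : Real.log (p ^ e p : ℕ) = Real.log (q ^ e q : ℕ) := Complex.ofReal_injective hpq
    have h2 : ((p ^ e p : ℕ) : ℝ) = (q ^ e q : ℕ) :=
      Real.log_injOn_pos (Set.mem_Ioi.2 (Nat.cast_pos.2 (pow_pos hp1.pos _)))
        (Set.mem_Ioi.2 (Nat.cast_pos.2 (pow_pos hq1.pos _))) h1
    have h3 : p ^ e p = q ^ e q := by exact_mod_cast h2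
    have h4 : p ∣ q ^ e q := h3 ▸ dvd_pow_self p (by have := (he p hp).1; omega)
    exact (Nat.prime_dvd_prime_iff_eq hp1 hq1).1 (hp1.dvd_of_dvd_pow h4)

open Polynomial in
/-- The functions `n ↦ α n * (log n) ^ i`, for `α` in a finite family of pairwise non-equivalent
multiplicative functions not equivalent to `1`, are linearly independent over `ℂ`, even when
restricted to the integers coprime to a given `N`. -/
theorem eq_zero_of_sum_mul_eval_log_eq_zero {ι : Type*} [Fintype ι]
    (α : ι → ArithmeticFunction ℂ) (hmul : ∀ j, (α j).IsMultiplicative)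
    (hne : ∀ j, ¬ Equivalent 1 (α j))
    (hpair : ∀ i j, i ≠ j → ¬ Equivalent (α i) (α j))
    (N : ℕ) (hN : N ≠ 0) (Q : ι → ℂ[X])
    (h : ∀ n : ℕ, n ≠ 0 → n.Coprime N → ∑ j, α j n * (Q j).eval (Real.log n : ℂ) = 0) :
    ∀ j, Q j = 0 := by
  classical
  -- `N` must vary: multiplicativity at `q n` needs `n` prime to `q`, so each elimination adds a
  -- prime to `N`.
  induction hd : ∑ j, polyWeight (Q j) using Nat.strong_induction_on generalizing N Q with
  | _ d ih =>
  by_contra! hcon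
  obtain ⟨i, hi⟩ := hcon
  by_cases hex : ∃ j, j ≠ i ∧ Q j ≠ 0
  · obtain ⟨j, hji, hj⟩ := hex
    obtain ⟨p, hp, hpN, e, -, hpe⟩ := (infinite_setOf_prime_not_dvd (hpair i j hji.symm) hN).nonempty
    set q := p ^ e with hq
    have hq0 : q ≠ 0 := pow_ne_zero _ hp.ne_zero
    have hlt : ∑ l, polyWeight (shiftSub (α l q) (α i q) (Real.log q) (Q l)) < d := by
      rw [← hd]
      refine Finset.sum_lt_sum (fun l _ => ?_) ⟨i, Finset.mem_univ _, ?_⟩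
      · by_cases hl : Q l = 0
        · simp [hl, shiftSub]
        · exact polyWeight_le_of_natDegree_le hl (natDegree_shiftSub_le _ _ _ _)
      · exact polyWeight_lt_of_coeff_eq_zero hi (natDegree_shiftSub_le _ _ _ _)
          (by rw [coeff_shiftSub, sub_self, zero_mul])
    -- By induction the new `j`-th polynomial is zero, yet its leading coefficient is `(α j q - α i
    -- q)` times that of `Q j`, which is nonzero.
    have hz := ih _ hlt (N * p) (mul_ne_zero hN hp.ne_zero)
      (fun l => shiftSub (α l q) (α i q) (Real.log q) (Q l)) ?_ rfl j
    · have h1 := coeff_shiftSub (α j q) (α i q) (Real.log q) (Q j)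
      rw [hz, coeff_zero] at h1
      rcases mul_eq_zero.1 h1.symm with h2 | h2
      · exact hpe (sub_eq_zero.1 h2).symm
      · exact hj (leadingCoeff_eq_zero.1 h2)
    · intro n hn hcop
      have hnN : n.Coprime N := Nat.Coprime.coprime_mul_right_right hcop
      have hnq : q.Coprime n := (Nat.Coprime.coprime_mul_left_right hcop).symm.pow_left e
      have hqN : q.Coprime N := ((Nat.Prime.coprime_iff_not_dvd hp).2 hpN).pow_left e
      have h1 := h n hn hnN
      have h2 := h (q * n) (mul_ne_zero hq0 hn) (Nat.Coprime.mul_left hqN hnN)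
      have hlog : ((Real.log (q * n : ℕ) : ℝ) : ℂ) = Real.log n + Real.log q := by
        rw [Nat.cast_mul, Real.log_mul (by exact_mod_cast hq0) (by exact_mod_cast hn)]
        push_cast
        ring
      calc ∑ l, α l n * (shiftSub (α l q) (α i q) (Real.log q) (Q l)).eval (Real.log n : ℂ)
          = ∑ l, α l (q * n) * (Q l).eval (Real.log (q * n : ℕ) : ℂ)
            - α i q * ∑ l, α l n * (Q l).eval (Real.log n : ℂ) := by
              rw [Finset.mul_sum, ← Finset.sum_sub_distrib]
              refine Finset.sum_congr rfl fun l _ => ?_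
              rw [eval_shiftSub, (hmul l).map_mul_of_coprime hnq, hlog]
              ring
        _ = 0 := by rw [h1, h2, mul_zero, sub_zero]
  · push Not at hex
    refine hi (eq_zero_of_mul_eval_log_eq_zero (hne i) hN fun n hn hc => ?_)
    have hsum := h n hn hc
    rwa [Fintype.sum_eq_single i fun l hl => by rw [hex l hl, eval_zero, mul_zero]] at hsum

/-! ### Entire functions of order `< 1` with exponential decay on a ray -/

/-- On `Re w > 0` the function `w ^ ρ`, `0 < ρ < 1`, has real part at least
`cos (ρ π / 2) |w| ^ ρ`. -/
theorem cos_mul_norm_rpow_le_re_cpow {ρ : ℝ} (h0 : 0 < ρ) (h1 : ρ < 1) {w : ℂ} (hw : 0 < w.re) :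
    Real.cos (ρ * (Real.pi / 2)) * ‖w‖ ^ ρ ≤ (w ^ (ρ : ℂ)).re := by
  have hw0 : w ≠ 0 := by rintro rfl; simp at hw
  have hn : 0 < ‖w‖ := norm_pos_iff.2 hw0
  have harg := Complex.abs_arg_le_pi_div_two_iff.2 hw.le
  rw [Complex.cpow_def_of_ne_zero hw0, Complex.exp_re, Complex.re_mul_ofReal,
    Complex.im_mul_ofReal, Complex.log_re, Complex.log_im, ← Real.rpow_def_of_pos hn, mul_comm]
  gcongr
  rw [← Real.cos_abs (w.arg * ρ), abs_mul, abs_of_pos h0, mul_comm ρ]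
  refine Real.cos_le_cos_of_nonneg_of_le_pi (by positivity) ?_ (by gcongr)
  nlinarith [Real.pi_pos]

/-- An entire function of order `< 1` that decays exponentially along the positive real axis is
zero. -/
theorem eq_zero_of_hasGrowth_of_exp_decay {f : ℂ → ℂ} (hf : Differentiable ℂ f) {ρ : ℝ}
    (h0 : 0 < ρ) (h1 : ρ < 1) (hg : HasGrowth f ρ) {a C : ℝ} (ha : 0 < a)
    (hC : ∀ x : ℝ, 0 ≤ x → ‖f x‖ ≤ C * Real.exp (-a * x)) : f = 0 := by
  obtain ⟨A, B, hA, hB, hAB⟩ := hg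
  have hpi := Real.pi_pos
  have hC0 : 0 ≤ C := by
    have := (norm_nonneg _).trans (hC 0 le_rfl)
    simpa using this
  set κ := Real.cos (ρ * (Real.pi / 2)) with hκ
  have hκ0 : 0 < κ := Real.cos_pos_of_mem_Ioo ⟨by nlinarith, by nlinarith⟩
  -- Chosen so that `K * Re ((1 + ζ) ^ ρ) ≥ B * ‖1 + ζ‖ ^ ρ`, which cancels the growth of `f`.
  set K := B / κ with hK
  have hK0 : 0 < K := by positivity
  -- The `log` term below grows on the imaginary axis at rate at most `c * π`; this has to equal the
  -- decay rate `a`.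
  set c := a / Real.pi with hc
  have hc0 : 0 < c := by positivity
  have hcpi : c * Real.pi = a := by rw [hc]; field_simp
  -- The term `-ζ log (1 + ζ)` gives superexponential decay on the positive axis. The linear term
  -- turns its imaginary-axis contribution into `Im ζ * (arg (1 + ζ) - π / 2)`, which is nonpositive
  -- for `Im ζ ≥ 0` and puts all growth on the side where `I * ζ` runs through the positive reals
  -- and `f` decays. The shift by `1` keeps `log` holomorphic on the closed half plane.
  set E : ℂ → ℂ := fun ζ =>
    c * (-ζ * Complex.log (1 + ζ) + Complex.I * (Real.pi / 2 : ℝ) * ζ)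
      - K * (1 + ζ) ^ (ρ : ℂ) with hE
  set G : ℂ → ℂ := fun ζ => f (Complex.I * ζ) * Complex.exp (E ζ) with hG
  have hnorm : ∀ ζ : ℂ, ‖G ζ‖ = ‖f (Complex.I * ζ)‖ * Real.exp (E ζ).re := fun ζ => by
    rw [hG, norm_mul, Complex.norm_exp]
  have hre : ∀ ζ : ℂ, 0 ≤ ζ.re → (E ζ).re ≤
      c * (-ζ.re * Real.log ‖1 + ζ‖ + ζ.im * ((1 + ζ).arg - Real.pi / 2)) - B * ‖1 + ζ‖ ^ ρ := by
    intro ζ hζ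
    have hw : 0 < (1 + ζ).re := by simp; linarith
    have h := cos_mul_norm_rpow_le_re_cpow h0 h1 hw
    have h' : B * ‖1 + ζ‖ ^ ρ ≤ K * ((1 + ζ) ^ (ρ : ℂ)).re := by
      have := mul_le_mul_of_nonneg_left h hK0.le
      rwa [← mul_assoc, show K * Real.cos (ρ * (Real.pi / 2)) = B by
        rw [hK, ← hκ]; field_simp] at this
    have : (E ζ).re = c * (-ζ.re * Real.log ‖1 + ζ‖ + ζ.im * ((1 + ζ).arg - Real.pi / 2))
        - K * ((1 + ζ) ^ (ρ : ℂ)).re := by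
      rw [hE, Complex.sub_re, Complex.re_ofReal_mul, Complex.re_ofReal_mul, Complex.add_re,
        Complex.mul_re, Complex.log_re, Complex.log_im, Complex.mul_re, Complex.mul_re,
        Complex.mul_im, Complex.neg_re, Complex.neg_im, Complex.I_re, Complex.I_im,
        Complex.ofReal_re, Complex.ofReal_im]
      ring
    rw [this]
    linarith
  have hnw : ∀ ζ : ℂ, 0 ≤ ζ.re → ‖ζ‖ ≤ ‖1 + ζ‖ := by
    intro ζ hζ
    rw [← sq_le_sq₀ (norm_nonneg _) (norm_nonneg _), ← Complex.normSq_eq_norm_sq,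
      ← Complex.normSq_eq_norm_sq, Complex.normSq_apply, Complex.normSq_apply]
    simp
    nlinarith
  have hlog : ∀ ζ : ℂ, 0 ≤ ζ.re → 0 ≤ Real.log ‖1 + ζ‖ := by
    intro ζ hζ
    refine Real.log_nonneg (le_trans ?_ (Complex.re_le_norm _))
    simp [hζ]
  have hbound : ∀ ζ : ℂ, 0 ≤ ζ.re → ‖G ζ‖ ≤
      A * Real.exp (c * (-ζ.re * Real.log ‖1 + ζ‖ + ζ.im * ((1 + ζ).arg - Real.pi / 2))) := by
    intro ζ hζ
    have hp : ‖ζ‖ ^ ρ ≤ ‖1 + ζ‖ ^ ρ := Real.rpow_le_rpow (norm_nonneg _) (hnw ζ hζ) h0.le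
    have hf1 := hAB (Complex.I * ζ)
    rw [norm_mul, Complex.norm_I, one_mul] at hf1
    rw [hnorm]
    refine (mul_le_mul hf1 (Real.exp_le_exp.2 (hre ζ hζ)) (Real.exp_pos _).le
      (by positivity)).trans ?_
    rw [mul_assoc, ← Real.exp_add]
    gcongr
    nlinarith
  have harg : ∀ ζ : ℂ, 0 ≤ ζ.re → |(1 + ζ).arg| ≤ Real.pi / 2 := fun ζ hζ =>
    Complex.abs_arg_le_pi_div_two_iff.2 (by simp; linarith)
  have hdiff : DiffContOnCl ℂ G {z | 0 < z.re} := by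
    apply DifferentiableOn.diffContOnCl
    rw [Complex.closure_setOfPred_lt_re]
    intro ζ hζ
    have hζ' : 0 ≤ ζ.re := hζ
    have hs : 1 + ζ ∈ Complex.slitPlane := Or.inl (by simp; linarith)
    have hd : DifferentiableAt ℂ (fun ζ : ℂ => 1 + ζ) ζ := by fun_prop
    refine DifferentiableAt.differentiableWithinAt ?_
    refine (hf _).fun_comp' ζ (by fun_prop) |>.mul (DifferentiableAt.cexp ?_)
    refine DifferentiableAt.sub (DifferentiableAt.const_mul (DifferentiableAt.add
      (DifferentiableAt.mul (by fun_prop) (hd.clog hs)) (by fun_prop)) _)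
      (DifferentiableAt.const_mul (hd.cpow (by fun_prop) hs) _)
  have hzero := PhragmenLindelof.eq_zero_on_right_half_plane_of_superexponential_decay hdiff
    ⟨1, by norm_num, a, ?_⟩ ?_ ⟨max A C, ?_⟩
  · have hana : AnalyticOnNhd ℂ f Set.univ := hf.differentiableOn.analyticOnNhd isOpen_univ
    -- Multiplication by `I` maps the right half plane to the upper one, so `f` vanishes near `I`.
    have hev : f =ᶠ[𝓝 Complex.I] 0 := by
      have hopen : IsOpen {z : ℂ | 0 < z.im} := isOpen_lt continuous_const Complex.continuous_im
      filter_upwards [hopen.mem_nhds (show (0 : ℝ) < Complex.I.im by simp)] with z hz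
      have := hzero (show -Complex.I * z ∈ {z : ℂ | 0 ≤ z.re} by simpa using le_of_lt hz)
      simp only [hG, Pi.zero_apply, mul_eq_zero, Complex.exp_ne_zero, or_false] at this
      rwa [← mul_assoc, mul_neg, Complex.I_mul_I, neg_neg, one_mul] at this
    funext z
    exact hana.eqOn_zero_of_preconnected_of_eventuallyEq_zero isPreconnected_univ
      (Set.mem_univ _) hev (Set.mem_univ z)
  · refine Asymptotics.IsBigO.of_bound A ?_
    rw [eventually_inf_principal]
    refine Eventually.of_forall fun ζ hζ => (hbound ζ (le_of_lt hζ)).trans ?_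
    have hζ' : 0 ≤ ζ.re := le_of_lt hζ
    rw [Real.norm_of_nonneg (Real.exp_pos _).le, Real.rpow_one]
    refine mul_le_mul_of_nonneg_left (Real.exp_le_exp.2 ?_) hA.le
    have h2 : ζ.im * ((1 + ζ).arg - Real.pi / 2) ≤ ‖ζ‖ * Real.pi := by
      refine (le_abs_self _).trans ?_
      rw [abs_mul]
      have := abs_le.1 (harg ζ hζ')
      exact mul_le_mul (Complex.abs_im_le_norm ζ) (abs_le.2 ⟨by linarith, by linarith⟩)
        (abs_nonneg _) (norm_nonneg _)
    have h3 := mul_nonneg hζ' (hlog ζ hζ')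
    calc _ ≤ c * (‖ζ‖ * Real.pi) := mul_le_mul_of_nonneg_left (by linarith) hc0.le
      _ = a * ‖ζ‖ := by rw [← hcpi]; ring
  · intro n
    have hlim : Tendsto (fun x : ℝ => A * Real.exp (-x)) atTop (𝓝 0) := by
      simpa using (Real.tendsto_exp_neg_atTop_nhds_zero.const_mul A)
    refine squeeze_zero' (Eventually.of_forall fun x => by positivity) ?_ hlim
    -- Beyond this threshold `c * x * log x ≥ (n + 1) * x`, which absorbs `exp x ^ n` and leaves
    -- `exp (-x)`.
    have hev : ∀ᶠ x : ℝ in atTop, (n + 1 : ℝ) / c ≤ Real.log x :=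
      Real.tendsto_log_atTop.eventually_ge_atTop _
    filter_upwards [hev, eventually_gt_atTop 0] with x hx hx0
    have hb := hbound x (by simpa using hx0.le)
    have hl : Real.log x ≤ Real.log ‖(1 : ℂ) + x‖ := by
      refine Real.log_le_log hx0 ?_
      have := hnw x (by simpa using hx0.le)
      rwa [Complex.norm_real, Real.norm_of_nonneg hx0.le] at this
    simp only [Complex.ofReal_re, Complex.ofReal_im, zero_mul, add_zero] at hb
    calc Real.exp x ^ n * ‖G x‖
        ≤ Real.exp x ^ n * (A * Real.exp (c * (-x * Real.log ‖(1 : ℂ) + x‖))) := by gcongr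
      _ = A * Real.exp (n * x + c * (-x * Real.log ‖(1 : ℂ) + x‖)) := by
          rw [← Real.exp_nat_mul, Real.exp_add]; ring
      _ ≤ A * Real.exp (-x) := by
          gcongr
          have h4 : (n + 1 : ℝ) ≤ c * Real.log ‖(1 : ℂ) + x‖ := by
            have := hx.trans hl
            rwa [div_le_iff₀' hc0] at this
          nlinarith
  · intro y
    have hr : ((y : ℂ) * Complex.I).re = 0 := by simp
    have hi : ((y : ℂ) * Complex.I).im = y := by simp
    have har := abs_le.1 (harg (y * Complex.I) hr.ge)
    rcases le_total 0 y with hy | hy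
    · refine (hbound _ hr.ge).trans (le_trans ?_ (le_max_left _ _))
      rw [hr, hi]
      refine mul_le_of_le_one_right hA.le (Real.exp_le_one_iff.2 ?_)
      have := mul_nonneg hy (sub_nonneg.2 har.2)
      refine mul_nonpos_of_nonneg_of_nonpos hc0.le ?_
      linarith
    -- Here the factor grows at most like `exp (-a * y)`, and the decay of `f` at `-y` cancels it
    -- exactly.
    · refine le_trans ?_ (le_max_right _ _)
      have hz : Complex.I * (y * Complex.I) = ((-y : ℝ) : ℂ) := by
        rw [mul_left_comm, Complex.I_mul_I]; push_cast; ring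
      have hE' := hre (y * Complex.I) hr.ge
      rw [hr, hi] at hE'
      rw [hnorm, hz]
      refine (mul_le_mul (hC (-y) (by linarith)) (Real.exp_le_exp.2 hE') (Real.exp_pos _).le
        (by positivity)).trans ?_
      rw [mul_assoc, ← Real.exp_add]
      refine mul_le_of_le_one_right hC0 (Real.exp_le_one_iff.2 ?_)
      have h5 : 0 ≤ B * ‖1 + (y : ℂ) * Complex.I‖ ^ ρ := by positivity
      have h6 : c * (y * ((1 + (y : ℂ) * Complex.I).arg - Real.pi / 2)) ≤ c * (-y * Real.pi) :=
        mul_le_mul_of_nonneg_left (by nlinarith) hc0.le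
      have h7 : c * (-y * Real.pi) = -a * y := by rw [← hcpi]; ring
      linarith

/-! ### Uniqueness of Dirichlet series with coefficients in `A` -/

theorem evalReal_sum_smul {k : ℝ} {ι : Type*} [Fintype ι] (c : ι → ℂ) (a : ι → Hol k)
    (x : Set.Ioi k) : evalReal (∑ i, c i • a i) x = ∑ i, c i * evalReal (a i) x := by
  let φ : Hol k →ₐ[ℂ] ℂ :=
    (Pi.evalAlgHom ℂ (fun _ : HalfPlane k => ℂ) ⟨((x : ℝ) : ℂ), x.2⟩).comp (Hol k).val
  change φ (∑ i, c i • a i) = ∑ i, c i * φ (a i)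
  simp [map_sum]

/-- The tail of a Dirichlet series decays like `n ^ (-x)`. -/
theorem norm_tsum_term_nat_add_le {c : ℕ → ℂ} {x₀ x : ℝ} (hc : LSeriesSummable c x₀)
    (hx : x₀ ≤ x) {n : ℕ} (hn : n ≠ 0) :
    ‖∑' m, LSeries.term c x (m + n)‖ ≤
      (n : ℝ) ^ (x₀ - x) * ∑' m, ‖LSeries.term c x₀ (m + n)‖ := by
  have hs : Summable fun m => ‖LSeries.term c x₀ (m + n)‖ :=
    ((summable_nat_add_iff n).2 hc).norm
  rw [← tsum_mul_left]
  refine tsum_of_norm_bounded (hs.mul_left _).hasSum fun m => ?_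
  have hm : m + n ≠ 0 := by omega
  have hn' : (0 : ℝ) < n := by exact_mod_cast Nat.pos_of_ne_zero hn
  have hm' : (0 : ℝ) < (m + n : ℕ) := by exact_mod_cast Nat.pos_of_ne_zero hm
  rw [LSeries.norm_term_eq, LSeries.norm_term_eq, if_neg hm, if_neg hm, Complex.ofReal_re,
    Complex.ofReal_re]
  have h1 : ((m + n : ℕ) : ℝ) ^ (x₀ - x) ≤ (n : ℝ) ^ (x₀ - x) :=
    Real.rpow_le_rpow_of_nonpos hn' (by push_cast; linarith [Nat.cast_nonneg (α := ℝ) m])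
      (by linarith)
  calc ‖c (m + n)‖ / ((m + n : ℕ) : ℝ) ^ x
      = ((m + n : ℕ) : ℝ) ^ (x₀ - x) * (‖c (m + n)‖ / ((m + n : ℕ) : ℝ) ^ x₀) := by
        rw [Real.rpow_sub hm']
        have := (Real.rpow_pos_of_pos hm' x₀).ne'
        field_simp
    _ ≤ _ := by gcongr

/-- Uniqueness of Dirichlet series with coefficients in an algebra of functions of subexponential
growth none of which, except zero, decays exponentially. -/
theorem sum_smul_eq_zero_of_sum_mul_LSeries_eq_zero {k : ℝ} {A : Subalgebra ℂ (Hol k)}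
    (hA : (A : Set (Hol k)) ⊆ (subexp k \ expDecay k) ∪ {0}) {ι : Type*} [Fintype ι]
    {a : ι → Hol k} (ha : ∀ i, a i ∈ A) {c : ι → ℕ → ℂ} {x₀ : ℝ}
    (hc : ∀ i, LSeriesSummable (c i) x₀)
    (h : ∀ x : Set.Ioi k, x₀ ≤ x →
      ∑ i, evalReal (a i) x * LSeries (c i) ((x : ℝ) : ℂ) = 0) (n : ℕ) (hn : n ≠ 0) :
    ∑ i, c i n • a i = 0 := by
  induction n using Nat.strong_induction_on with
  | _ n ih =>
  have hmem : ∑ i, c i n • a i ∈ A := A.sum_mem fun i _ => A.smul_mem (ha i) _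
  -- The `n`-th combination lies in `A`, so it suffices to show that it decays exponentially.
  refine (hA hmem).resolve_left fun hnot => hnot.2 ?_
  have hn' : (0 : ℝ) < n := by exact_mod_cast Nat.pos_of_ne_zero hn
  set T : ι → ℝ := fun i => ∑' m, ‖LSeries.term (c i) x₀ (m + (n + 1))‖ with hT
  have hmain : ∀ x : Set.Ioi k, x₀ ≤ x → ‖evalReal (∑ i, c i n • a i) x‖ ≤
      (n : ℝ) ^ (x : ℝ) * ∑ i, ‖evalReal (a i) x‖ * (((n + 1 : ℕ) : ℝ) ^ (x₀ - x) * T i) := by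
    intro x hx
    have hs : ∀ i, LSeriesSummable (c i) ((x : ℝ) : ℂ) := fun i =>
      (hc i).of_re_le_re (by simpa using hx)
    have h0 := h x hx
    have hsplit : ∀ i, LSeries (c i) ((x : ℝ) : ℂ) =
        ∑ m ∈ Finset.range (n + 1), LSeries.term (c i) ((x : ℝ) : ℂ) m
          + ∑' m, LSeries.term (c i) ((x : ℝ) : ℂ) (m + (n + 1)) := fun i =>
      ((hs i).sum_add_tsum_nat_add (n + 1)).symm
    have hhead : ∑ i, evalReal (a i) x *
        ∑ m ∈ Finset.range (n + 1), LSeries.term (c i) ((x : ℝ) : ℂ) m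
        = evalReal (∑ i, c i n • a i) x / (n : ℂ) ^ ((x : ℝ) : ℂ) := by
      simp_rw [Finset.mul_sum]
      rw [Finset.sum_comm]
      have hterm : ∀ m, m ≠ 0 → ∑ i, evalReal (a i) x * LSeries.term (c i) ((x : ℝ) : ℂ) m
          = evalReal (∑ i, c i m • a i) x / (m : ℂ) ^ ((x : ℝ) : ℂ) := by
        intro m hm
        rw [evalReal_sum_smul, Finset.sum_div]
        refine Finset.sum_congr rfl fun i _ => ?_
        rw [LSeries.term_of_ne_zero hm]
        ring
      -- Only the `n`-th term survives: lower ones vanish by induction, and `LSeries.term` is zero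
      -- at index `0`.
      rw [Finset.sum_range_succ, hterm n hn, Finset.sum_eq_zero, zero_add]
      intro m hm
      rcases eq_or_ne m 0 with rfl | hm0
      · simp
      · rw [hterm m hm0, ih m (Finset.mem_range.1 hm) hm0]
        simp [evalReal]
    simp_rw [hsplit, mul_add, Finset.sum_add_distrib] at h0
    rw [hhead] at h0
    have hpos : (0 : ℝ) < (n : ℝ) ^ (x : ℝ) := Real.rpow_pos_of_pos hn' _
    have hnorm := congrArg norm (eq_neg_of_add_eq_zero_left h0)
    rw [norm_div, norm_neg, Complex.norm_natCast_cpow_of_pos (Nat.pos_of_ne_zero hn),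
      Complex.ofReal_re, div_eq_iff hpos.ne', mul_comm] at hnorm
    rw [hnorm]
    gcongr
    refine (norm_sum_le _ _).trans (Finset.sum_le_sum fun i _ => ?_)
    rw [norm_mul]
    gcongr
    exact norm_tsum_term_nat_add_le (hc i) hx (Nat.succ_ne_zero n)
  have hN' : (0 : ℝ) < (n + 1 : ℕ) := by positivity
  -- The ratio `(n / (n + 1)) ^ x` equals `exp (-2 * δ * x)`: one half is the decay rate to prove,
  -- the other absorbs the subexponential `a i`.
  set δ := (Real.log (n + 1 : ℕ) - Real.log n) / 2 with hδ
  have hδ0 : 0 < δ := by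
    have : Real.log n < Real.log (n + 1 : ℕ) := Real.log_lt_log hn' (by push_cast; linarith)
    rw [hδ]; linarith
  refine ⟨δ, hδ0, ?_⟩
  have hsub : ∀ i, a i ∈ subexp k := by
    intro i
    rcases hA (ha i) with h1 | h1
    · exact h1.1
    · rw [Set.mem_singleton_iff.1 h1]
      intro b _
      simp [evalReal]
  have hlim : Tendsto (fun x : Set.Ioi k => ∑ i, ((n + 1 : ℕ) : ℝ) ^ x₀ * T i *
      (Real.exp (-δ * x) * ‖evalReal (a i) x‖)) atTop (𝓝 0) := by
    have := tendsto_finsetSum (Finset.univ : Finset ι) fun i _ =>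
      (hsub i δ hδ0).const_mul (((n + 1 : ℕ) : ℝ) ^ x₀ * T i)
    simpa using this
  refine squeeze_zero' (Eventually.of_forall fun x => by positivity) ?_ hlim
  have hev : ∀ᶠ x : Set.Ioi k in atTop, x₀ ≤ x :=
    (eventually_ge_atTop (⟨max x₀ (k + 1), Set.mem_Ioi.2 (lt_max_of_lt_right (lt_add_one k))⟩ : Set.Ioi k)).mono
      fun x hx => (le_max_left x₀ (k + 1)).trans hx
  filter_upwards [hev] with x hx
  refine (mul_le_mul_of_nonneg_left (hmain x hx) (Real.exp_pos _).le).trans (le_of_eq ?_)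
  rw [Finset.mul_sum, Finset.mul_sum]
  refine Finset.sum_congr rfl fun i _ => ?_
  have hexp : Real.exp (δ * x) * (n : ℝ) ^ (x : ℝ) * ((n + 1 : ℕ) : ℝ) ^ (x₀ - x) =
      ((n + 1 : ℕ) : ℝ) ^ x₀ * Real.exp (-δ * x) := by
    rw [Real.rpow_def_of_pos hn', Real.rpow_def_of_pos hN', Real.rpow_def_of_pos hN',
      ← Real.exp_add, ← Real.exp_add, ← Real.exp_add, hδ]
    congr 1
    ring
  linear_combination (‖evalReal (a i) x‖ * T i) * hexp

/-! ### Clearing denominators -/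

/-- Elements of the field of fractions of `A` have a common denominator. -/
theorem exists_common_denominator {k : ℝ} (A : Subalgebra ℂ (Hol k)) {ι : Type*} [Fintype ι]
    (g : ι → quotientField A) :
    ∃ d ∈ A, d ≠ 0 ∧ ∀ i, ∃ a ∈ A,
      algebraMap (Hol k) (Mer k) d * (g i : Mer k) = algebraMap (Hol k) (Mer k) a := by
  classical
  have key : ∀ i, ∃ b ∈ A, b ≠ 0 ∧ ∃ a ∈ A,
      algebraMap (Hol k) (Mer k) b * (g i : Mer k) = algebraMap (Hol k) (Mer k) a := by
    intro i
    obtain ⟨a, ha, b, hb, hab⟩ := (mem_quotientField A _).1 (g i).2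
    by_cases hb0 : b = 0
    -- Division by zero yields `0`, so `0 / 1` represents this element.
    · exact ⟨1, A.one_mem, one_ne_zero, 0, A.zero_mem, by rw [← hab, hb0]; simp⟩
    · refine ⟨b, hb, hb0, a, ha, ?_⟩
      rw [← hab, mul_div_cancel₀]
      exact fun h => hb0 (IsFractionRing.injective (Hol k) (Mer k) (h.trans (map_zero _).symm))
  choose b hb hb0 a ha hab using key
  refine ⟨∏ i, b i, A.prod_mem fun i _ => hb i, Finset.prod_ne_zero_iff.2 fun i _ => hb0 i,
    fun i => ⟨(∏ j ∈ Finset.univ.erase i, b j) * a i,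
      A.mul_mem (A.prod_mem fun j _ => hb j) (ha i), ?_⟩⟩
  rw [← Finset.prod_erase_mul _ _ (Finset.mem_univ i), map_mul, map_mul, mul_assoc, hab]

/-- Linear independence over the field of fractions of `A` can be tested over `A`. -/
theorem linearIndependent_quotientField {k : ℝ} {A : Subalgebra ℂ (Hol k)} {ι : Type*} [Fintype ι]
    {v : ι → Hol k}
    (h : ∀ a : ι → Hol k, (∀ i, a i ∈ A) → ∑ i, a i * v i = 0 → ∀ i, a i = 0) :
    LinearIndependent (quotientField A) fun i => algebraMap (Hol k) (Mer k) (v i) := by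
  rw [Fintype.linearIndependent_iff]
  intro g hg i
  obtain ⟨d, -, hd0, hd⟩ := exists_common_denominator A g
  choose a ha hga using hd
  have hinj : Function.Injective (algebraMap (Hol k) (Mer k)) := IsFractionRing.injective _ _
  have hsum : ∑ i, a i * v i = 0 := by
    apply hinj
    rw [map_sum, map_zero]
    calc ∑ i, algebraMap (Hol k) (Mer k) (a i * v i)
        = algebraMap (Hol k) (Mer k) d * ∑ i, g i • algebraMap (Hol k) (Mer k) (v i) := by
          rw [Finset.mul_sum]
          refine Finset.sum_congr rfl fun i _ => ?_
          rw [map_mul, ← hga, Subfield.smul_def, smul_eq_mul, mul_assoc]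
      _ = 0 := by rw [hg, mul_zero]
  have := hga i
  rw [h a ha hsum i, map_zero] at this
  rcases mul_eq_zero.1 this with h1 | h1
  · exact absurd (hinj (h1.trans (map_zero _).symm)) hd0
  · exact_mod_cast h1

/-! ### Independence of the derivatives over the fraction field -/

theorem iterate_logMul_apply (f : ℕ → ℂ) (i n : ℕ) :
    (LSeries.logMul^[i] f) n = (Real.log n : ℂ) ^ i * f n := by
  induction i with
  | zero => simp
  | succ i ih =>
    rw [Function.iterate_succ_apply', LSeries.logMul, ih, pow_succ', mul_assoc,
      Complex.natCast_log]

open Polynomial in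
theorem linearIndependent_dirichletDeriv {k : ℝ} {ι : Type*} [Fintype ι] (m : ℕ)
    (α : ι → ArithmeticFunction ℂ) (hα : ∀ j, α j ∈ polyGrowth k)
    (hmul : ∀ j, (α j).IsMultiplicative) (hne : ∀ j, ¬ Equivalent 1 (α j))
    (hpair : ∀ i j, i ≠ j → ¬ Equivalent (α i) (α j)) (A : Subalgebra ℂ (Hol (k + 1)))
    (hA : (A : Set (Hol (k + 1))) ⊆ (subexp (k + 1) \ expDecay (k + 1)) ∪ {0}) :
    LinearIndependent (quotientField A)
      (fun ji : ι × Fin (m + 1) => algebraMap (Hol (k + 1)) (Mer (k + 1))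
        (dirichletDeriv (α ji.1) (hα ji.1) ji.2)) := by
  refine linearIndependent_quotientField fun a ha hsum => ?_
  have habs : ∀ j (x : ℝ), k + 1 < x → LSeries.abscissaOfAbsConv (α j) < ((x : ℂ).re : EReal) :=
    fun j x hx => (abscissa_le (hα j)).trans_lt (by exact_mod_cast hx)
  have hcoeff := sum_smul_eq_zero_of_sum_mul_LSeries_eq_zero hA
    -- The sign from differentiating `n ^ (-z)` is moved into the coefficients from `A`. The
    -- abscissa `x₀ = k + 2` could be any real number above `k + 1`.
    (a := fun ji : ι × Fin (m + 1) => (-1 : ℂ) ^ (ji.2 : ℕ) • a ji)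
    (fun ji => A.smul_mem (ha ji) _)
    (c := fun ji : ι × Fin (m + 1) => LSeries.logMul^[(ji.2 : ℕ)] (α ji.1)) (x₀ := k + 2)
    (fun ji => LSeriesSummable_of_abscissaOfAbsConv_lt_re (by
      rw [LSeries.absicssaOfAbsConv_logPowMul]
      exact habs ji.1 (k + 2) (by linarith)))
    (fun x _ => by
      have hx := congrArg (fun f : Hol (k + 1) => evalReal f x) hsum
      let φ : Hol (k + 1) →ₐ[ℂ] ℂ := (Pi.evalAlgHom ℂ (fun _ : HalfPlane (k + 1) => ℂ)
        ⟨((x : ℝ) : ℂ), x.2⟩).comp (Hol (k + 1)).val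
      change φ _ = φ 0 at hx
      rw [map_sum, map_zero] at hx
      rw [← hx]
      refine Finset.sum_congr rfl fun ji _ => ?_
      have hd : φ (dirichletDeriv (α ji.1) (hα ji.1) ji.2)
          = (-1) ^ (ji.2 : ℕ) * LSeries (LSeries.logMul^[(ji.2 : ℕ)] (α ji.1)) ((x : ℝ) : ℂ) :=
        LSeries_iteratedDeriv _ (habs ji.1 x x.2)
      change φ ((-1 : ℂ) ^ (ji.2 : ℕ) • a ji) * _ = _
      rw [map_mul, hd, map_smul, smul_eq_mul]
      ring)
  rintro ⟨j, i⟩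
  -- Evaluation at a fixed `z` turns the identities between holomorphic functions into a numerical
  -- relation for every `n ≥ 1`; taking `N = 1` imposes no coprimality.
  ext z
  have hQ := eq_zero_of_sum_mul_eval_log_eq_zero α hmul hne hpair 1 one_ne_zero
    (fun j => ∑ i : Fin (m + 1), C ((-1) ^ (i : ℕ) * (a (j, i)).1 z) * X ^ (i : ℕ))
    (fun n hn _ => by
      let φ : Hol (k + 1) →ₐ[ℂ] ℂ := (Pi.evalAlgHom ℂ (fun _ : HalfPlane (k + 1) => ℂ)
        z).comp (Hol (k + 1)).val
      have h := congrArg φ (hcoeff n hn)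
      rw [map_sum, map_zero, Fintype.sum_prod_type] at h
      rw [← h]
      refine Finset.sum_congr rfl fun j _ => ?_
      rw [eval_finsetSum, Finset.mul_sum]
      refine Finset.sum_congr rfl fun i _ => ?_
      rw [map_smul, map_smul, iterate_logMul_apply, smul_eq_mul, smul_eq_mul, eval_C_mul,
        eval_pow, eval_X]
      change _ = _ * (_ * (a (j, i)).1 z)
      ring) j
  have h := congrArg (fun p : ℂ[X] => p.coeff i) hQ
  simp only [finsetSum_coeff, coeff_C_mul, coeff_X_pow, coeff_zero] at h
  rw [Finset.sum_eq_single i (fun l _ hl => by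
    rw [if_neg fun he => hl (Fin.ext he.symm), mul_zero])
    (fun hi => absurd (Finset.mem_univ i) hi)] at h
  simpa using h

/-! ### Admissibility of the entire functions of order `< 1` -/

/-- Since `ρ < 1`, eventually `B * x ^ ρ ≤ a / 2 * x`, so half of the factor `exp (-a * x)` remains.
-/
theorem restrict_mem_subexp (k : ℝ) {f : Entire} (hf : f ∈ entireOrderLTOne) :
    restrict k f ∈ subexp k := by
  obtain ⟨ρ, h0, h1, A, B, hA, hB, hAB⟩ := (growthOrder_lt_iff f.1 1).1 hf
  intro a ha
  have hval : Tendsto (fun x : Set.Ioi k => (x : ℝ)) atTop atTop := tendsto_Ioi_atTop.1 tendsto_id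
  have hlim : Tendsto (fun x : ℝ => A * Real.exp (-x)) atTop (𝓝 0) := by
    simpa using (Real.tendsto_exp_neg_atTop_nhds_zero.const_mul A)
  have hlim' : Tendsto (fun x : Set.Ioi k => A * Real.exp (-(a / 2 * x))) atTop (𝓝 0) :=
    hlim.comp (hval.const_mul_atTop (half_pos ha))
  have hev : ∀ᶠ x : ℝ in atTop, x ^ ρ ≤ a / (2 * B) * x := by
    filter_upwards [(tendsto_rpow_neg_atTop (sub_pos.2 h1)).eventually_le_const
      (show 0 < a / (2 * B) by positivity), eventually_gt_atTop 0] with x hx hx0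
    rw [neg_sub, Real.rpow_sub_one hx0.ne', div_le_iff₀ hx0] at hx
    exact hx
  refine squeeze_zero' (Eventually.of_forall fun x => by positivity) ?_ hlim'
  filter_upwards [hval.eventually hev, hval.eventually_gt_atTop 0] with x hx hx0
  have hfx : ‖evalReal (restrict k f) x‖ ≤ A * Real.exp (B * (x : ℝ) ^ ρ) := by
    have := hAB ((x : ℝ) : ℂ)
    rwa [Complex.norm_real, Real.norm_of_nonneg hx0.le] at this
  calc Real.exp (-a * x) * ‖evalReal (restrict k f) x‖
      ≤ Real.exp (-a * x) * (A * Real.exp (B * (x : ℝ) ^ ρ)) := by gcongr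
    _ = A * Real.exp (-a * x + B * (x : ℝ) ^ ρ) := by rw [Real.exp_add]; ring
    _ ≤ A * Real.exp (-(a / 2 * x)) := by
      gcongr
      have h2 := mul_le_mul_of_nonneg_left hx hB.le
      have h3 : B * (a / (2 * B) * x) = a / 2 * x := by field_simp
      linarith

/-- The decay is known only for large `x`; compactness extends the bound to all `x ≥ 0`, as the
Phragmén–Lindelöf argument requires. -/
theorem eq_zero_of_restrict_mem_expDecay {k : ℝ} {f : Entire} (hf : f ∈ entireOrderLTOne)
    (hdec : restrict k f ∈ expDecay k) : f = 0 := by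
  obtain ⟨ρ, h0, h1, hg⟩ := (growthOrder_lt_iff f.1 1).1 hf
  have hfd : Differentiable ℂ f.1 := f.2
  obtain ⟨a, ha, hlim⟩ := hdec
  obtain ⟨x₁, hx₁⟩ := eventually_atTop.1 (hlim.eventually_le_const one_pos)
  obtain ⟨M, hM⟩ := (isCompact_Icc (a := (0 : ℝ)) (b := x₁)).exists_bound_of_continuousOn
    (f := fun x : ℝ => Real.exp (a * x) * ‖f.1 x‖) (by
      have := hfd.continuous
      fun_prop)
  refine Subtype.ext (eq_zero_of_hasGrowth_of_exp_decay hfd h0 h1 hg ha (C := max M 1)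
    fun x hx => ?_)
  have hb : Real.exp (a * x) * ‖f.1 x‖ ≤ max M 1 := by
    rcases le_total x x₁ with hle | hle
    · exact (le_abs_self _).trans ((hM x ⟨hx, hle⟩).trans (le_max_left _ _))
    · exact (hx₁ ⟨x, Set.mem_Ioi.2 (x₁.2.trans_le hle)⟩ hle).trans (le_max_right _ _)
  rw [neg_mul, Real.exp_neg, ← div_eq_mul_inv, le_div_iff₀ (Real.exp_pos _), mul_comm]
  exact hb

/-- The algebra of entire functions of order `< 1` satisfies the growth condition. -/
theorem map_restrict_entireOrderLTOne_subset (k : ℝ) :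
    ((entireOrderLTOne.map (restrict k) : Subalgebra ℂ (Hol k)) : Set (Hol k)) ⊆
      (subexp k \ expDecay k) ∪ {0} := by
  rintro _ ⟨f, hf, rfl⟩
  by_cases hdec : restrict k f ∈ expDecay k
  · right
    rw [eq_zero_of_restrict_mem_expDecay hf hdec]
    exact map_zero (restrict k)
  · exact Or.inl ⟨restrict_mem_subexp k hf, hdec⟩

end DirichletIndep

end

open DirichletIndep in
theorem proposition3p2 (k : ℝ) (r m : ℕ) (α : Fin r → ArithmeticFunction ℂ)
    (hα : ∀ j, α j ∈ polyGrowth k)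
    (hmul : ∀ j, (α j).IsMultiplicative)
    (hne : ∀ j, ¬ Equivalent 1 (α j))
    (hpair : ∀ i j, i ≠ j → ¬ Equivalent (α i) (α j)) :
    (∀ A : Subalgebra ℂ (Hol (k + 1)),
      (A : Set (Hol (k + 1))) ⊆ (subexp (k + 1) \ expDecay (k + 1)) ∪ {0} →
      LinearIndependent (quotientField A)
        (fun ji : Fin r × Fin (m + 1) =>
          algebraMap (Hol (k + 1)) (Mer (k + 1))
            (dirichletDeriv (α ji.1) (hα ji.1) ji.2))) ∧
    LinearIndependent (meromorphicOrderLTOne (k + 1))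
      (fun ji : Fin r × Fin (m + 1) =>
        algebraMap (Hol (k + 1)) (Mer (k + 1))
          (dirichletDeriv (α ji.1) (hα ji.1) ji.2)) :=
  ⟨linearIndependent_dirichletDeriv m α hα hmul hne hpair,
    linearIndependent_dirichletDeriv m α hα hmul hne hpair _
      (map_restrict_entireOrderLTOne_subset (k + 1))⟩
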